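/- Conventions. An $n$-dimensional orbifold $Y$ (not necessarily effective) is presented by a proper étale Lie groupoid. Let a discrete group $G$ act on $Y$ by automorphisms of this groupoid that are smooth on objects and arrows; the case of interest is the orbifold universal cover $Y$ of an orbifold $X=Y/G$, with $G=\pi_1^{orb}(X)$ acting by deck transformations. Let $\alpha\in H^2(G,U(1))$, computed with normalized $2$-cocycles $\alpha_{g,h}$. For a cocycle put $\gamma(\alpha)_{g,h}=\alpha_{g,h}\alpha_{h,g}^{-1}$; on commuting pairs this depends only on the class, and $\gamma_g:=L^\alpha_g:C(g)\to U(1)$, $h\mapsto\gamma(\alpha)_{g,h}$, is a character of the centralizer $C(g)$ of $g$ in $G$. For $g_1,\dots,g_k\in G$ let $Y_{g_1}\cap\dots\cap Y_{g_k}$ be the common fixed locus in the orbifold sense: its points are tuples $(y,k_1,\dots,k_k)$ where $y$ is an object and $k_i$ is an arrow of $Y$ from $y$ to $g_iy$, and its arrows are the arrows $a:y\to y'$ of $Y$ with $k_i'\circ a=(g_ia)\circ k_i$ for all $i$. (If $Y$ is a manifold, this is the usual set of common fixed points.) The common centralizer $C(g_1,\dots,g_k)$ acts on it, and the quotient orbifold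 (action groupoid) $X_{(g_1,\dots,g_k)}=(Y_{g_1}\cap\dots\cap Y_{g_k})/C(g_1,\dots,g_k)$ is the multi-sector; $X_{(g)}=Y_g/C(g)$ is the case $k=1$. A flat complex orbifold line bundle over such a groupoid is a flat complex line bundle over its space of objects with a functorial, linear, locally constant action of the arrows. Isomorphisms are isomorphisms of flat line bundles that commute with the arrows, and $L^{-1}$ is the dual bundle. For a character $\chi$ of a group $C$ acting on $Z$, let $Z\times_\chi\mathbf C$ be the flat orbifold line bundle over $Z/C$ obtained from $Z\times\mathbf C$ with $h(z,v)=(hz,\chi(h)v)$. Put $$L_g=Y_g\times_{L^\alpha_g}\mathbf C\to X_{(g)},\qquad L_{(g_1,\dots,g_k)}=(Y_{g_1}\cap\dots\cap Y_{g_k})\times_{\gamma_{g_1\cdots g_k}}\mathbf C\to X_{(g_1,\dots,g_k)},$$ where $\gamma_{g_1\cdots g_k}$ is restricted to $C(g_1,\dots,g_k)\subseteq C(g_1\cdots g_k)$. Lemma 4.2. (1) For all $g,t\in G$, translation by $t$ together with $t_\#:C(g)\to C(tgt^{-1})$, $h\mapsto tht^{-1}$, is an isomorphism $X_{(g)}\to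 X_{(tgt^{-1})}$ of topological groupoids, and $t\times\mathrm{Id}:Y_g\times\mathbf C\to Y_{tgt^{-1}}\times\mathbf C$ is an isomorphism of flat orbifold line bundles $L_g\cong L_{tgt^{-1}}$ over it. Hence, up to isomorphism, $L_g$ depends only on the conjugacy class of $g$, and is denoted $L_{(g)}$. (2) For every $g\in G$, the map $I:X_{(g)}\to X_{(g^{-1})}$, $(y,k)\mapsto(y,g^{-1}k^{-1})$, together with the identity $C(g)=C(g^{-1})$, is an isomorphism of topological groupoids, and $L_{(g)}^{-1}\cong I^*L_{(g^{-1})}$ as flat orbifold line bundles over $X_{(g)}$. (3) For all $k\ge 0$ and $g_1,\dots,g_k\in G$, let $e_i:X_{(g_1,\dots,g_k)}\to X_{(g_i)}$ be the evaluation maps, induced by the inclusions $Y_{g_1}\cap\dots\cap Y_{g_k}\subseteq Y_{g_i}$ (which keep only $k_i$) and $C(g_1,\dots,g_k)\subseteq C(g_i)$. Then, as flat orbifold line bundles over $X_{(g_1,\dots,g_k)}$, $$L_{(g_1,\dots,g_k)}\cong e_1^*L_{(g_1)}\otimes\dots\otimes e_k^*L_{(g_k)}.$$ -/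

import Mathlib

open scoped Manifold ContDiff Topology TensorProduct

namespace DiscreteTorsion

universe u v w

set_option linter.checkUnivs false

/-! ## Group cohomology in degree two, phases and twisted characters -/

/-- Normalized `U(1)`-valued 2-cocycles of `G` (trivial action). -/
noncomputable def Z2 (G : Type v) [Group G] : Subgroup (G → G → Circle) where
  carrier := {α | (∀ g, α g 1 = 1 ∧ α 1 g = 1) ∧
    ∀ g h k, α g (h * k) * α h k = α g h * α (g * h) k}
  one_mem' := by simp
  mul_mem' := by
    rintro a b ⟨ha, ha'⟩ ⟨hb, hb'⟩
    refine ⟨fun g => by simp [ha g, hb g], fun g h k => ?_⟩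
    simp only [Pi.mul_apply]
    rw [mul_mul_mul_comm, ha', hb', mul_mul_mul_comm]
  inv_mem' := by
    rintro a ⟨ha, ha'⟩
    refine ⟨fun g => by simp [ha g], fun g h k => ?_⟩
    simp only [Pi.inv_apply]
    rw [← mul_inv, ha', mul_inv]

/-- Coboundaries `(δρ)_{g,h} = ρ_g ρ_h ρ_{gh}⁻¹` of maps `ρ` with `ρ_1 = 1`. -/
noncomputable def B2 (G : Type v) [Group G] : Subgroup (G → G → Circle) where
  carrier := {β | ∃ ρ : G → Circle, ρ 1 = 1 ∧ ∀ g h, β g h = ρ g * ρ h * (ρ (g * h))⁻¹}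
  one_mem' := ⟨1, by simp, by simp⟩
  mul_mem' := by
    rintro a b ⟨ρ, h1, h⟩ ⟨σ, k1, k⟩
    refine ⟨ρ * σ, by simp [h1, k1], fun x y => ?_⟩
    simp only [Pi.mul_apply, h, k, mul_inv]
    ac_rfl
  inv_mem' := by
    rintro a ⟨ρ, h1, h⟩
    refine ⟨ρ⁻¹, by simp [h1], fun x y => ?_⟩
    simp [h, mul_comm]

/-- `H²(G, U(1))`; its elements are the discrete torsions. -/
abbrev H2 (G : Type v) [Group G] : Type v := Z2 G ⧸ (B2 G).subgroupOf (Z2 G)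

/-- The phase `γ(α)_{g,h} = α_{g,h} α_{h,g}⁻¹`. -/
noncomputable def phase {G : Type v} (α : G → G → Circle) (g h : G) : Circle := α g h * (α h g)⁻¹

theorem phase_mul_right {G : Type v} [Group G] {α : G → G → Circle} (hα : α ∈ Z2 G)
    {g h k : G} (hgh : g * h = h * g) (hgk : g * k = k * g) :
    phase α g (h * k) = phase α g h * phase α g k := by
  have e1 := hα.2 g h k
  have e2 := hα.2 h g k
  have e3 := hα.2 h k g
  rw [hgh] at e1
  rw [hgk] at e2
  have f1 : α g (h * k) = α g h * α (h * g) k * (α h k)⁻¹ := by rw [← e1]; group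
  have f2 : α (h * g) k = (α h g)⁻¹ * (α h (k * g) * α g k) := by rw [e2]; group
  have f3 : α h (k * g) = α h k * α (h * k) g * (α k g)⁻¹ := by rw [← e3]; group
  unfold phase
  rw [f1, f2, f3]
  trans α g h * (α h g)⁻¹ * (α g k * (α k g)⁻¹) * (α h k * (α h k)⁻¹) *
    (α (h * k) g * (α (h * k) g)⁻¹)
  · ac_rfl
  · simp

/-- The twisted character `γ(α)_{g,·} : C(g) → U(1)` of a cocycle. -/
noncomputable def cocycleChar {G : Type v} [Group G] (α : Z2 G) (g : G) :
    Subgroup.centralizer {g} →* Circle where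
  toFun h := phase α.1 g h
  map_one' := by simp [phase, (α.2.1 g).1, (α.2.1 g).2]
  map_mul' h k := phase_mul_right α.2
    (Subgroup.mem_centralizer_singleton_iff.1 h.2).symm
    (Subgroup.mem_centralizer_singleton_iff.1 k.2).symm

/-- The twisted character `L^α_g : C(g) → U(1)`, `h ↦ γ(α)_{g,h}`, of a class `α ∈ H²(G, U(1))`.
It is computed on any representing cocycle. -/
noncomputable def twistedChar {G : Type v} [Group G] (α : H2 G) (g : G) :
    Subgroup.centralizer {g} →* Circle :=
  QuotientGroup.lift ((B2 G).subgroupOf (Z2 G))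
    { toFun := fun α => cocycleChar α g
      map_one' := by ext h; simp [cocycleChar, phase]
      map_mul' := fun α β => by
        ext h
        simp [cocycleChar, phase]
        ring }
    (by
      rintro ⟨β, hβ⟩ ⟨ρ, h1, h⟩
      ext x
      have hx := Subgroup.mem_centralizer_singleton_iff.1 x.2
      simp only [Subgroup.subtype_apply] at h
      simp only [MonoidHom.coe_mk, OneHom.coe_mk, cocycleChar, phase, h, hx,
        mul_comm (ρ x) (ρ g), mul_inv_cancel, MonoidHom.one_apply]) α

/-! ## Topological groupoids, orbifolds, group actions -/

/-- A topological groupoid. `comp a b` is the arrow "first `a`, then `b`". -/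
structure TopGroupoid where
  Obj : Type u
  Arr : Type v
  [topObj : TopologicalSpace Obj]
  [topArr : TopologicalSpace Arr]
  src : Arr → Obj
  tgt : Arr → Obj
  unit : Obj → Arr
  inv : Arr → Arr
  comp : ∀ a b : Arr, tgt a = src b → Arr
  src_unit : ∀ x, src (unit x) = x
  tgt_unit : ∀ x, tgt (unit x) = x
  src_inv : ∀ a, src (inv a) = tgt a
  tgt_inv : ∀ a, tgt (inv a) = src a
  src_comp : ∀ a b h, src (comp a b h) = src a
  tgt_comp : ∀ a b h, tgt (comp a b h) = tgt b
  unit_comp : ∀ a, comp (unit (src a)) a (tgt_unit _) = a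
  comp_unit : ∀ a, comp a (unit (tgt a)) (src_unit _).symm = a
  inv_comp : ∀ a, comp (inv a) a (tgt_inv a) = unit (tgt a)
  comp_inv : ∀ a, comp a (inv a) (src_inv a).symm = unit (src a)
  assoc : ∀ a b c (h : tgt a = src b) (h' : tgt b = src c),
    comp (comp a b h) c ((tgt_comp a b h).trans h') =
      comp a (comp b c h') (h.trans (src_comp b c h').symm)
  continuous_src : Continuous src
  continuous_tgt : Continuous tgt
  continuous_unit : Continuous unit
  continuous_inv : Continuous inv
  continuous_comp :
    Continuous fun p : {p : Arr × Arr // tgt p.1 = src p.2} => comp p.1.1 p.1.2 p.2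

attribute [instance] TopGroupoid.topObj TopGroupoid.topArr
attribute [simp] TopGroupoid.src_unit TopGroupoid.tgt_unit TopGroupoid.src_inv
  TopGroupoid.tgt_inv TopGroupoid.src_comp TopGroupoid.tgt_comp

theorem TopGroupoid.comp_congr (Z : TopGroupoid.{u, v}) {a a' b b' : Z.Arr} (ha : a = a')
    (hb : b = b') (h : Z.tgt a = Z.src b) (h' : Z.tgt a' = Z.src b') :
    Z.comp a b h = Z.comp a' b' h' := by
  subst ha hb; rfl

theorem TopGroupoid.inv_comp_eq (Z : TopGroupoid.{u, v}) {a b c k : Z.Arr}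
    (h1 : Z.tgt a = Z.src c) (h2 : Z.tgt k = Z.src b) (e : Z.comp a c h1 = Z.comp k b h2)
    (h3 : Z.tgt (Z.inv k) = Z.src a) (h4 : Z.tgt b = Z.src (Z.inv c)) :
    Z.comp (Z.inv k) a h3 = Z.comp b (Z.inv c) h4 := by
  have s1 : Z.comp (Z.comp k b h2) (Z.inv c) (by simp [h4]) = a := by
    simp only [← e]
    rw [Z.assoc a c (Z.inv c) h1 (by simp)]
    have u := Z.comp_unit a
    simp only [h1] at u
    simp only [Z.comp_inv, u]
  rw [Z.comp_congr rfl s1.symm h3 (by simp), Z.comp_congr rfl (Z.assoc k b _ h2 h4) _ (by simp),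
    ← Z.assoc (Z.inv k) k _ (by simp) (by simp [h2])]
  have u := Z.unit_comp (Z.comp b (Z.inv c) h4)
  simp only [Z.src_comp, ← h2] at u
  simp only [Z.inv_comp, u]

/-- An `n`-dimensional smooth orbifold (not necessarily effective), presented as a proper étale
Lie groupoid: objects and arrows form smooth Hausdorff manifolds, source and target are local
diffeomorphisms, and `(src, tgt)` is proper. Its local group at `x` is the finite group of
arrows `x → x`, and a small enough neighbourhood of `x` is an orbifold chart for this group.
(As source and target are local diffeomorphisms, the continuous structure maps are smooth.) -/
structure Orbifold (n : ℕ) extends TopGroupoid.{u, v} where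
  [chartedObj : ChartedSpace (EuclideanSpace ℝ (Fin n)) Obj]
  [chartedArr : ChartedSpace (EuclideanSpace ℝ (Fin n)) Arr]
  [manifoldObj : IsManifold (𝓡 n) ∞ Obj]
  [manifoldArr : IsManifold (𝓡 n) ∞ Arr]
  [t2Obj : T2Space Obj]
  [t2Arr : T2Space Arr]
  src_localDiffeo : IsLocalDiffeomorph (𝓡 n) (𝓡 n) ∞ src
  tgt_localDiffeo : IsLocalDiffeomorph (𝓡 n) (𝓡 n) ∞ tgt
  proper : IsProperMap fun a => (src a, tgt a)

attribute [instance] Orbifold.chartedObj Orbifold.chartedArr Orbifold.manifoldObj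
  Orbifold.manifoldArr Orbifold.t2Obj Orbifold.t2Arr

/-- An action of a (discrete) group `H` on a topological groupoid by automorphisms. -/
structure GroupoidAction (H : Type w) [Group H] (Z : TopGroupoid.{u, v}) where
  obj : H → Z.Obj → Z.Obj
  arr : H → Z.Arr → Z.Arr
  continuous_obj : ∀ h, Continuous (obj h)
  continuous_arr : ∀ h, Continuous (arr h)
  obj_one : ∀ x, obj 1 x = x
  obj_mul : ∀ h k x, obj (h * k) x = obj h (obj k x)
  arr_one : ∀ a, arr 1 a = a
  arr_mul : ∀ h k a, arr (h * k) a = arr h (arr k a)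
  src_arr : ∀ h a, Z.src (arr h a) = obj h (Z.src a)
  tgt_arr : ∀ h a, Z.tgt (arr h a) = obj h (Z.tgt a)
  arr_unit : ∀ h x, arr h (Z.unit x) = Z.unit (obj h x)
  arr_comp : ∀ h a b (e : Z.tgt a = Z.src b),
    arr h (Z.comp a b e) =
      Z.comp (arr h a) (arr h b) (by rw [tgt_arr, src_arr, e])

attribute [simp] GroupoidAction.obj_one GroupoidAction.arr_one
  GroupoidAction.src_arr GroupoidAction.tgt_arr GroupoidAction.arr_unit

/-- An action of a (discrete) group on an orbifold by diffeomorphisms. -/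
structure SmoothAction (G : Type w) [Group G] {n : ℕ} (Y : Orbifold.{u, v} n) extends
    GroupoidAction G Y.toTopGroupoid where
  smooth_obj : ∀ g, ContMDiff (𝓡 n) (𝓡 n) ∞ (obj g)
  smooth_arr : ∀ g, ContMDiff (𝓡 n) (𝓡 n) ∞ (arr g)

/-- A continuous homomorphism (functor) of topological groupoids. -/
structure TopGroupoid.Hom (Z W : TopGroupoid.{u, v}) where
  obj : Z.Obj → W.Obj
  arr : Z.Arr → W.Arr
  continuous_obj : Continuous obj
  continuous_arr : Continuous arr
  src_arr : ∀ a, W.src (arr a) = obj (Z.src a)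
  tgt_arr : ∀ a, W.tgt (arr a) = obj (Z.tgt a)
  arr_unit : ∀ x, arr (Z.unit x) = W.unit (obj x)
  arr_comp : ∀ a b (e : Z.tgt a = Z.src b),
    arr (Z.comp a b e) =
      W.comp (arr a) (arr b) (by rw [tgt_arr, src_arr, e])

/-- `φ` is an isomorphism of topological groupoids. -/
def TopGroupoid.Hom.IsIso {Z W : TopGroupoid.{u, v}} (φ : Z.Hom W) : Prop :=
  IsHomeomorph φ.obj ∧ IsHomeomorph φ.arr

-- Continuity into and out of a disjoint union of copies of a space.
theorem continuous_sigma_mk' {H : Type w} {T : Type*} {X : Type*} [TopologicalSpace T] [TopologicalSpace X]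
    {f : T → H} {k : T → X} (hf : IsLocallyConstant f) (hk : Continuous k) :
    Continuous fun t => (⟨f t, k t⟩ : Σ _ : H, X) := by
  rw [continuous_iff_continuousAt]
  intro t
  have h1 : ContinuousAt (fun s => (⟨f t, k s⟩ : Σ _ : H, X)) t :=
    (continuous_sigmaMk.comp hk).continuousAt
  refine h1.congr ?_
  filter_upwards [hf.eventually_eq t] with s hs
  rw [hs]

theorem isLocallyConstant_fst {H : Type w} {X : Type*} [TopologicalSpace X] :
    IsLocallyConstant (fun p : Σ _ : H, X => p.1) := by
  rw [IsLocallyConstant.iff_exists_open]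
  rintro ⟨h, x⟩
  refine ⟨Set.range (Sigma.mk h), isOpen_range_sigmaMk, ⟨x, rfl⟩, ?_⟩
  rintro _ ⟨y, rfl⟩
  rfl

theorem continuous_sigma_snd {H : Type w} {X : Type*} [TopologicalSpace X] :
    Continuous fun p : Σ _ : H, X => p.2 :=
  continuous_sigma fun _ => continuous_id

namespace GroupoidAction

variable {H : Type w} [Group H] {Z : TopGroupoid.{u, v}} (A : GroupoidAction H Z)

@[simp] theorem obj_inv_obj (h : H) (x : Z.Obj) : A.obj h⁻¹ (A.obj h x) = x := by
  rw [← A.obj_mul]; simp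

@[simp] theorem obj_obj_inv (h : H) (x : Z.Obj) : A.obj h (A.obj h⁻¹ x) = x := by
  rw [← A.obj_mul]; simp

@[simp] theorem arr_inv_arr (h : H) (a : Z.Arr) : A.arr h⁻¹ (A.arr h a) = a := by
  rw [← A.arr_mul]; simp

@[simp] theorem arr_arr_inv (h : H) (a : Z.Arr) : A.arr h (A.arr h⁻¹ a) = a := by
  rw [← A.arr_mul]; simp

theorem continuous_act : Continuous fun p : Σ _ : H, Z.Arr => A.arr p.1 p.2 :=
  continuous_sigma fun h => A.continuous_arr h

theorem continuous_actObj : Continuous fun p : Σ _ : H, Z.Obj => A.obj p.1 p.2 :=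
  continuous_sigma fun h => A.continuous_obj h

theorem arr_inv_comm (h : H) (a : Z.Arr) : A.arr h (Z.inv a) = Z.inv (A.arr h a) := by
  have e : Z.comp (A.arr h (Z.inv a)) (A.arr h a) (by simp) = Z.unit (A.obj h (Z.tgt a)) := by
    rw [← A.arr_comp h (Z.inv a) a (by simp), Z.inv_comp]; simp
  have e' := Z.assoc (A.arr h (Z.inv a)) (A.arr h a) (Z.inv (A.arr h a)) (by simp) (by simp)
  simp only [e, Z.comp_inv] at e'
  have u1 := Z.unit_comp (Z.inv (A.arr h a))
  have u2 := Z.comp_unit (A.arr h (Z.inv a))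
  simp only [Z.src_inv, Z.tgt_inv, A.src_arr, A.tgt_arr] at u1 u2 e'
  rw [← u1, ← u2]
  exact e'.symm

/-- The quotient orbifold `Z/H`: an arrow `(h, a)` of it is the arrow `a` of `Z` followed by the
translation by `h`. The topology of `Σ _ : H, Z.Arr` is that of the disjoint union, so that `H`
is discrete. -/
def quotient : TopGroupoid.{u, max v w} where
  Obj := Z.Obj
  Arr := Σ _ : H, Z.Arr
  src p := Z.src p.2
  tgt p := A.obj p.1 (Z.tgt p.2)
  unit x := ⟨1, Z.unit x⟩
  inv p := ⟨p.1⁻¹, A.arr p.1 (Z.inv p.2)⟩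
  comp p q e := ⟨q.1 * p.1, Z.comp p.2 (A.arr p.1⁻¹ q.2) (by simp [← e])⟩
  src_unit x := by simp
  tgt_unit x := by simp
  src_inv p := by simp
  tgt_inv p := by simp
  src_comp p q e := by simp
  tgt_comp p q e := by simp [A.obj_mul]
  unit_comp p := by
    rcases p with ⟨h, a⟩
    have := Z.unit_comp a
    simpa using this
  comp_unit p := by
    rcases p with ⟨h, a⟩
    have := Z.comp_unit a
    simpa using this
  inv_comp p := by
    rcases p with ⟨h, a⟩
    simp only [inv_inv, mul_inv_cancel, A.arr_inv_comm, Z.inv_comp, A.tgt_arr]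
  comp_inv p := by
    rcases p with ⟨h, a⟩
    simp only [inv_mul_cancel, A.arr_inv_arr, Z.comp_inv]
  assoc p q r e e' := by
    rcases p with ⟨h, a⟩
    rcases q with ⟨k, b⟩
    rcases r with ⟨l, c⟩
    simp only at e e'
    simp only [mul_assoc, mul_inv_rev, A.arr_mul]
    congr 1
    rw [Z.assoc a (A.arr h⁻¹ b) (A.arr h⁻¹ (A.arr k⁻¹ c)) (by simp [← e]) (by simp [← e'])]
    simp only [A.arr_comp]
  continuous_src := Z.continuous_src.comp continuous_sigma_snd
  continuous_tgt := continuous_sigma fun h => (A.continuous_obj h).comp Z.continuous_tgt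
  continuous_unit := continuous_sigmaMk.comp Z.continuous_unit
  continuous_inv := continuous_sigma fun h =>
    (continuous_sigmaMk (σ := fun _ : H => Z.Arr) (i := h⁻¹)).comp
      ((A.continuous_arr h).comp Z.continuous_inv)
  continuous_comp := by
    let P := {p : (Σ _ : H, Z.Arr) × (Σ _ : H, Z.Arr) //
        A.obj p.1.1 (Z.tgt p.1.2) = Z.src p.2.2}
    have c1 : Continuous fun p : P => p.1.1 := continuous_fst.comp continuous_subtype_val
    have c2 : Continuous fun p : P => p.1.2 := continuous_snd.comp continuous_subtype_val
    have l1 : IsLocallyConstant fun p : P => p.1.1.1 :=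
      (isLocallyConstant_fst (H := H) (X := Z.Arr)).comp_continuous c1
    have l2 : IsLocallyConstant fun p : P => p.1.2.1 :=
      (isLocallyConstant_fst (H := H) (X := Z.Arr)).comp_continuous c2
    refine continuous_sigma_mk' (l2.mul l1) ?_
    have e : ∀ p : P, Z.tgt p.1.1.2 = Z.src (A.arr p.1.1.1⁻¹ p.1.2.2) := fun p => by
      simp [← p.2]
    refine Z.continuous_comp.comp (Continuous.subtype_mk
      (f := fun p : P => (p.1.1.2, A.arr p.1.1.1⁻¹ p.1.2.2)) ?_ e)
    exact (continuous_sigma_snd.comp c1).prodMk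
      (A.continuous_act.comp (continuous_sigma_mk' l1.inv (continuous_sigma_snd.comp c2)))

/-! ## Fixed loci and multi-sectors -/

variable {ι : Type}

/-- The points of `Y_{g_1} ∩ ⋯ ∩ Y_{g_k}`: points `y` with arrows `k_i : y → g_i y`. (If all
arrows are identities, i.e. for a manifold, this says `g_i y = y`. In general `k_i` records by
which element of the orbifold chart, lifting `g_i`, the point is fixed.) -/
def FixedObj (g : ι → H) : Type (max u v) :=
  {p : Z.Obj × (ι → Z.Arr) //
    ∀ i, Z.src (p.2 i) = p.1 ∧ Z.tgt (p.2 i) = A.obj (g i) p.1}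

instance (g : ι → H) : TopologicalSpace (A.FixedObj g) :=
  inferInstanceAs (TopologicalSpace {p : Z.Obj × (ι → Z.Arr) //
    ∀ i, Z.src (p.2 i) = p.1 ∧ Z.tgt (p.2 i) = A.obj (g i) p.1})

/-- `a` is an arrow from `(y, k)` to `(y', k')` if `k'_i ∘ a = (g_i a) ∘ k_i` for all `i`. -/
def IsFixedArr (g : ι → H) (p q : A.FixedObj g) (a : Z.Arr) : Prop :=
  Z.src a = p.1.1 ∧ Z.tgt a = q.1.1 ∧
    ∀ i (h : Z.tgt a = Z.src (q.1.2 i)) (h' : Z.tgt (p.1.2 i) = Z.src (A.arr (g i) a)),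
      Z.comp a (q.1.2 i) h = Z.comp (p.1.2 i) (A.arr (g i) a) h'

theorem IsFixedArr.comp {g : ι → H} {p q r : A.FixedObj g} {a b : Z.Arr}
    (ha : A.IsFixedArr g p q a) (hb : A.IsFixedArr g q r b) (e : Z.tgt a = Z.src b) :
    A.IsFixedArr g p r (Z.comp a b e) := by
  refine ⟨by simp [ha.1], by simp [hb.2.1], fun i h h' => ?_⟩
  have hq := q.2 i
  have hp := p.2 i
  have e1 : Z.tgt b = Z.src (r.1.2 i) := by rw [hb.2.1, (r.2 i).1]
  have e2 : Z.tgt (q.1.2 i) = Z.src (A.arr (g i) b) := by rw [hq.2, A.src_arr, hb.1]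
  have e3 : Z.tgt a = Z.src (q.1.2 i) := by rw [ha.2.1, hq.1]
  have e4 : Z.tgt (p.1.2 i) = Z.src (A.arr (g i) a) := by rw [hp.2, A.src_arr, ha.1]
  have e5 : Z.tgt (A.arr (g i) a) = Z.src (A.arr (g i) b) := by rw [A.tgt_arr, A.src_arr, e]
  rw [Z.assoc a b (r.1.2 i) e e1]
  simp only [hb.2.2 i e1 e2]
  rw [← Z.assoc a (q.1.2 i) (A.arr (g i) b) e3 e2]
  simp only [ha.2.2 i e3 e4]
  rw [Z.assoc (p.1.2 i) (A.arr (g i) a) (A.arr (g i) b) e4 e5]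
  simp only [A.arr_comp]

theorem isFixedArr_unit {g : ι → H} (p : A.FixedObj g) : A.IsFixedArr g p p (Z.unit p.1.1) := by
  refine ⟨by simp, by simp, fun i h h' => ?_⟩
  have hp := p.2 i
  have u1 := Z.unit_comp (p.1.2 i)
  have u2 := Z.comp_unit (p.1.2 i)
  simp only [hp.1] at u1
  simp only [hp.2] at u2
  simp only [A.arr_unit, u1, u2]

theorem IsFixedArr.inv {g : ι → H} {p q : A.FixedObj g} {a : Z.Arr}
    (ha : A.IsFixedArr g p q a) : A.IsFixedArr g q p (Z.inv a) := by
  refine ⟨by simp [ha.2.1], by simp [ha.1], fun i h h' => ?_⟩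
  have hq := q.2 i
  have hp := p.2 i
  have e3 : Z.tgt a = Z.src (q.1.2 i) := by rw [ha.2.1, hq.1]
  have e4 : Z.tgt (p.1.2 i) = Z.src (A.arr (g i) a) := by rw [hp.2, A.src_arr, ha.1]
  have key := (ha.2.2 i e3 e4).symm
  have e5 : Z.tgt (q.1.2 i) = Z.src (Z.inv (A.arr (g i) a)) := by
    rw [Z.src_inv, hq.2, A.tgt_arr, ha.2.1]
  have e6 : Z.tgt (Z.inv a) = Z.src (p.1.2 i) := by rw [Z.tgt_inv, ha.1, hp.1]
  rw [Z.inv_comp_eq e4 e3 key e6 e5]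
  exact Z.comp_congr rfl (A.arr_inv_comm _ _).symm _ _

theorem continuous_fixed_base (g : ι → H) : Continuous fun p : A.FixedObj g => p.1.1 :=
  continuous_fst.comp continuous_subtype_val

theorem continuous_fixed_arr (g : ι → H) (i : ι) :
    Continuous fun p : A.FixedObj g => p.1.2 i :=
  (continuous_apply i).comp (continuous_snd.comp continuous_subtype_val)

theorem continuous_fixed_mk {T : Type*} [TopologicalSpace T] {g : ι → H} {f : T → A.FixedObj g}
    (h1 : Continuous fun t => (f t).1.1) (h2 : ∀ i, Continuous fun t => (f t).1.2 i) :
    Continuous f :=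
  continuous_induced_rng.2 (h1.prodMk (continuous_pi h2))

/-- The fixed locus `Y_{g_1} ∩ ⋯ ∩ Y_{g_k}` as a topological groupoid. -/
def fixedLocus (g : ι → H) : TopGroupoid.{max u v, max u v} where
  Obj := A.FixedObj g
  Arr := {q : (A.FixedObj g × A.FixedObj g) × Z.Arr // A.IsFixedArr g q.1.1 q.1.2 q.2}
  src q := q.1.1.1
  tgt q := q.1.1.2
  unit p := ⟨((p, p), Z.unit p.1.1), A.isFixedArr_unit p⟩
  inv q := ⟨((q.1.1.2, q.1.1.1), Z.inv q.1.2), IsFixedArr.inv A q.2⟩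
  comp q r e := ⟨((q.1.1.1, r.1.1.2), Z.comp q.1.2 r.1.2 (by rw [q.2.2.1, r.2.1, e])),
    IsFixedArr.comp A q.2 (e ▸ r.2) _⟩
  src_unit p := rfl
  tgt_unit p := rfl
  src_inv q := rfl
  tgt_inv q := rfl
  src_comp q r e := rfl
  tgt_comp q r e := rfl
  unit_comp := by
    rintro ⟨⟨⟨p, q⟩, a⟩, ha⟩
    have u := Z.unit_comp a
    simp only [ha.1] at u
    simp only [u]
  comp_unit := by
    rintro ⟨⟨⟨p, q⟩, a⟩, ha⟩
    have u := Z.comp_unit a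
    simp only [ha.2.1] at u
    simp only [u]
  inv_comp := by
    rintro ⟨⟨⟨p, q⟩, a⟩, ha⟩
    simp only [Z.inv_comp, ha.2.1]
  comp_inv := by
    rintro ⟨⟨⟨p, q⟩, a⟩, ha⟩
    simp only [Z.comp_inv, ha.1]
  assoc q r s e e' := by
    refine Subtype.ext (Prod.ext rfl ?_)
    exact Z.assoc q.1.2 r.1.2 s.1.2 (by rw [q.2.2.1, r.2.1, e]) (by rw [r.2.2.1, s.2.1, e'])
  continuous_src := continuous_fst.comp (continuous_fst.comp continuous_subtype_val)
  continuous_tgt := continuous_snd.comp (continuous_fst.comp continuous_subtype_val)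
  continuous_unit := Continuous.subtype_mk
    ((continuous_id.prodMk continuous_id).prodMk
      (Z.continuous_unit.comp (A.continuous_fixed_base g))) _
  continuous_inv := Continuous.subtype_mk
    (((continuous_snd.comp (continuous_fst.comp continuous_subtype_val)).prodMk
      (continuous_fst.comp (continuous_fst.comp continuous_subtype_val))).prodMk
      (Z.continuous_inv.comp (continuous_snd.comp continuous_subtype_val))) _
  continuous_comp := by
    let F := {q : (A.FixedObj g × A.FixedObj g) × Z.Arr // A.IsFixedArr g q.1.1 q.1.2 q.2}
    let P := {p : F × F // p.1.1.1.2 = p.2.1.1.1}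
    have c1 : Continuous fun p : P => p.1.1.1 :=
      continuous_subtype_val.comp (continuous_fst.comp continuous_subtype_val)
    have c2 : Continuous fun p : P => p.1.2.1 :=
      continuous_subtype_val.comp (continuous_snd.comp continuous_subtype_val)
    have e : ∀ p : P, Z.tgt p.1.1.1.2 = Z.src p.1.2.1.2 := fun p => by
      rw [p.1.1.2.2.1, p.1.2.2.1, p.2]
    refine Continuous.subtype_mk (Continuous.prodMk
      ((continuous_fst.comp (continuous_fst.comp c1)).prodMk
        (continuous_snd.comp (continuous_fst.comp c2))) ?_) _
    exact Z.continuous_comp.comp (Continuous.subtype_mk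
      (f := fun p : P => (p.1.1.1.2, p.1.2.1.2))
      ((continuous_snd.comp c1).prodMk (continuous_snd.comp c2)) e)

/-- The centralizer `C(g_1, …, g_k)`. -/
abbrev cent (g : ι → H) : Subgroup H := Subgroup.centralizer (Set.range g)

theorem cent_comm {g : ι → H} (h : cent g) (i : ι) : g i * h = h * g i :=
  Subgroup.mem_centralizer_iff.1 h.2 _ ⟨i, rfl⟩

/-- Translation `(y, k) ↦ (ty, tk)` from the fixed locus of `(g_i)` to that of `(t g_i t⁻¹)`; it is
written for any tuple `g'` with `t g_i = g'_i t`. -/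
def moveObj {g g' : ι → H} (t : H) (ht : ∀ i, t * g i = g' i * t) (p : A.FixedObj g) :
    A.FixedObj g' :=
  ⟨(A.obj t p.1.1, fun i => A.arr t (p.1.2 i)), fun i => by
    simp only [A.src_arr, A.tgt_arr, (p.2 i).1, (p.2 i).2, ← A.obj_mul, ht i, and_self]⟩

theorem isFixedArr_move {g g' : ι → H} (t : H) (ht : ∀ i, t * g i = g' i * t)
    {p q : A.FixedObj g} {a : Z.Arr} (ha : A.IsFixedArr g p q a) :
    A.IsFixedArr g' (A.moveObj t ht p) (A.moveObj t ht q) (A.arr t a) := by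
  refine ⟨by simp [moveObj, ha.1], by simp [moveObj, ha.2.1], fun i h h' => ?_⟩
  have e3 : Z.tgt a = Z.src (q.1.2 i) := by rw [ha.2.1, (q.2 i).1]
  have e4 : Z.tgt (p.1.2 i) = Z.src (A.arr (g i) a) := by rw [(p.2 i).2, A.src_arr, ha.1]
  have := congrArg (A.arr t) (ha.2.2 i e3 e4)
  simp only [A.arr_comp, ← A.arr_mul, ht i] at this
  simp only [moveObj, ← A.arr_mul]
  exact this

theorem continuous_moveObj {g g' : ι → H} (t : H) (ht : ∀ i, t * g i = g' i * t) :
    Continuous (A.moveObj t ht) :=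
  A.continuous_fixed_mk ((A.continuous_obj t).comp (A.continuous_fixed_base g))
    fun i => (A.continuous_arr t).comp (A.continuous_fixed_arr g i)

/-- Translation by `t` on the arrows of a fixed locus. -/
def moveArr {g g' : ι → H} (t : H) (ht : ∀ i, t * g i = g' i * t) (q : (A.fixedLocus g).Arr) :
    (A.fixedLocus g').Arr :=
  ⟨((A.moveObj t ht q.1.1.1, A.moveObj t ht q.1.1.2), A.arr t q.1.2), A.isFixedArr_move t ht q.2⟩

theorem continuous_moveArr {g g' : ι → H} (t : H) (ht : ∀ i, t * g i = g' i * t) :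
    Continuous (A.moveArr t ht) :=
  Continuous.subtype_mk
    ((((A.continuous_moveObj t ht).comp (A.fixedLocus g).continuous_src).prodMk
      ((A.continuous_moveObj t ht).comp (A.fixedLocus g).continuous_tgt)).prodMk
      ((A.continuous_arr t).comp (continuous_snd.comp continuous_subtype_val))) _

/-- The action of `C(g_1, …, g_k)` on `Y_{g_1} ∩ ⋯ ∩ Y_{g_k}`. -/
def fixedAction (g : ι → H) : GroupoidAction (cent g) (A.fixedLocus g) where
  obj h := A.moveObj (h : H) fun i => (cent_comm h i).symm
  arr h := A.moveArr (h : H) fun i => (cent_comm h i).symm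
  continuous_obj _ := A.continuous_moveObj _ _
  continuous_arr _ := A.continuous_moveArr _ _
  obj_one _ := Subtype.ext (Prod.ext (A.obj_one _) (funext fun _ => A.arr_one _))
  obj_mul _ _ _ := Subtype.ext (Prod.ext (A.obj_mul _ _ _) (funext fun _ => A.arr_mul _ _ _))
  arr_one _ := Subtype.ext (Prod.ext (Prod.ext
    (Subtype.ext (Prod.ext (A.obj_one _) (funext fun _ => A.arr_one _)))
    (Subtype.ext (Prod.ext (A.obj_one _) (funext fun _ => A.arr_one _)))) (A.arr_one _))
  arr_mul _ _ _ := Subtype.ext (Prod.ext (Prod.ext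
    (Subtype.ext (Prod.ext (A.obj_mul _ _ _) (funext fun _ => A.arr_mul _ _ _)))
    (Subtype.ext (Prod.ext (A.obj_mul _ _ _) (funext fun _ => A.arr_mul _ _ _))))
    (A.arr_mul _ _ _))
  src_arr _ _ := rfl
  tgt_arr _ _ := rfl
  arr_unit _ _ := Subtype.ext (Prod.ext rfl (A.arr_unit _ _))
  arr_comp _ _ _ _ := Subtype.ext (Prod.ext rfl (A.arr_comp _ _ _ _))

/-- The multi-sector `X_{(g_1, …, g_k)} = (Y_{g_1} ∩ ⋯ ∩ Y_{g_k}) / C(g_1, …, g_k)`. -/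
def multiSector (g : ι → H) : TopGroupoid.{max u v, max u v w} := (A.fixedAction g).quotient

/-- The sector `X_{(g)} = Y_g / C(g)`: the multi-sector of the 1-tuple `(g)`. -/
abbrev sector (g : H) : TopGroupoid.{max u v, max u v w} := A.multiSector fun _ : Fin 1 => g

/-- The isomorphism `t_# : C(g) → C(tgt⁻¹)`, `h ↦ tht⁻¹`. -/
def conjCent (t g : H) (h : cent fun _ : Fin 1 => g) : cent fun _ : Fin 1 => t * g * t⁻¹ :=
  ⟨t * h * t⁻¹, Subgroup.mem_centralizer_iff.2 (by
    rintro _ ⟨i, rfl⟩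
    have e : g * h = h * g := cent_comm h i
    simp only [mul_assoc, inv_mul_cancel_left]
    rw [← mul_assoc g, e, mul_assoc])⟩

/-- The map `X_{(g)} → X_{(tgt⁻¹)}` given by `t : Y_g → Y_{tgt⁻¹}` and
`t_# : C(g) → C(tgt⁻¹)`. -/
def translate (t g : H) : (A.sector g).Hom (A.sector (t * g * t⁻¹)) where
  obj := A.moveObj t fun _ => by group
  arr q := ⟨conjCent t g q.1, A.moveArr t (fun _ => by group) q.2⟩
  continuous_obj := A.continuous_moveObj t _
  continuous_arr := continuous_sigma fun h =>
    (continuous_sigmaMk (σ := fun _ : cent (fun _ : Fin 1 => t * g * t⁻¹) =>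
      (A.fixedLocus fun _ : Fin 1 => t * g * t⁻¹).Arr) (i := conjCent t g h)).comp (A.continuous_moveArr t fun _ => by group)
  src_arr _ := rfl
  tgt_arr q := Subtype.ext (Prod.ext (by
      change A.obj (t * q.1 * t⁻¹) (A.obj t _) = A.obj t (A.obj q.1 _)
      rw [← A.obj_mul, ← A.obj_mul, inv_mul_cancel_right]
      rfl) (funext fun i => by
      change A.arr (t * q.1 * t⁻¹) (A.arr t _) = A.arr t (A.arr q.1 _)
      rw [← A.arr_mul, ← A.arr_mul, inv_mul_cancel_right]
      rfl))
  arr_unit p := by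
    refine Sigma.ext (Subtype.ext (by change t * 1 * t⁻¹ = 1; group)) (heq_of_eq ?_)
    exact Subtype.ext (Prod.ext rfl (A.arr_unit _ _))
  arr_comp q r e := by
    have ho : ∀ x, A.obj t (A.obj ((q.1 : H)⁻¹) x) = A.obj ((t * q.1 * t⁻¹)⁻¹) (A.obj t x) := by
      intro x
      rw [← A.obj_mul, ← A.obj_mul]
      congr 1
      group
    have ha : ∀ x, A.arr t (A.arr ((q.1 : H)⁻¹) x) = A.arr ((t * q.1 * t⁻¹)⁻¹) (A.arr t x) := by
      intro x
      rw [← A.arr_mul, ← A.arr_mul]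
      congr 1
      group
    refine Sigma.ext (Subtype.ext ?_) (heq_of_eq ?_)
    · change t * (r.1 * q.1) * t⁻¹ = (t * r.1 * t⁻¹) * (t * q.1 * t⁻¹)
      group
    · refine Subtype.ext (Prod.ext (Prod.ext rfl
        (Subtype.ext (Prod.ext (ho _) (funext fun i => ha _)))) ?_)
      exact (A.arr_comp _ _ _ _).trans (Z.comp_congr rfl (ha _) _ _)

/-- The map `(y, k) ↦ (y, g⁻¹ k⁻¹)` from the fixed locus of `g` to that of `g⁻¹`: if `k` goes from
`y` to `g y` then `g⁻¹ k⁻¹` goes from `y` to `g⁻¹ y`. -/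
def invObj (g : H) (p : A.FixedObj fun _ : Fin 1 => g) : A.FixedObj fun _ : Fin 1 => g⁻¹ :=
  ⟨(p.1.1, fun i => A.arr g⁻¹ (Z.inv (p.1.2 i))), fun i => by
    simp [(p.2 i).1, (p.2 i).2]⟩

theorem isFixedArr_invObj (g : H) {p q : A.FixedObj fun _ : Fin 1 => g} {a : Z.Arr}
    (ha : A.IsFixedArr _ p q a) : A.IsFixedArr _ (A.invObj g p) (A.invObj g q) a := by
  refine ⟨ha.1, ha.2.1, fun i h h' => ?_⟩
  have e3 : Z.tgt a = Z.src (q.1.2 i) := by rw [ha.2.1, (q.2 i).1]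
  have e4 : Z.tgt (p.1.2 i) = Z.src (A.arr g a) := by rw [(p.2 i).2, A.src_arr, ha.1]
  have e5 : Z.tgt (Z.inv (p.1.2 i)) = Z.src a := by rw [Z.tgt_inv, (p.2 i).1, ha.1]
  have e6 : Z.tgt (A.arr g a) = Z.src (Z.inv (q.1.2 i)) := by
    rw [Z.src_inv, (q.2 i).2, A.tgt_arr, ha.2.1]
  have := congrArg (A.arr g⁻¹) (Z.inv_comp_eq e3 e4 (ha.2.2 i e3 e4) e5 e6)
  simp only [A.arr_comp, A.arr_inv_arr] at this
  exact this.symm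

theorem continuous_invObj (g : H) : Continuous (A.invObj g) :=
  A.continuous_fixed_mk (A.continuous_fixed_base _) fun i =>
    (A.continuous_arr _).comp (Z.continuous_inv.comp (A.continuous_fixed_arr _ i))

/-- The equality `C(g) = C(g⁻¹)`. -/
def invCent (g : H) (h : cent fun _ : Fin 1 => g) : cent fun _ : Fin 1 => g⁻¹ :=
  ⟨h, Subgroup.mem_centralizer_iff.2 (by
    rintro _ ⟨i, rfl⟩
    exact ((show Commute g (h : H) from cent_comm h i).inv_left).eq)⟩

theorem invObj_move (g : H) (h : cent fun _ : Fin 1 => g) (p : A.FixedObj fun _ : Fin 1 => g) :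
    (A.fixedAction _).obj (invCent g h) (A.invObj g p) =
      A.invObj g ((A.fixedAction _).obj h p) := by
  refine Subtype.ext (Prod.ext rfl (funext fun i => ?_))
  change A.arr h (A.arr g⁻¹ (Z.inv (p.1.2 i))) = A.arr g⁻¹ (Z.inv (A.arr h (p.1.2 i)))
  rw [← A.arr_inv_comm, ← A.arr_mul, ← A.arr_mul,
    ((show Commute g (h : H) from cent_comm h i).inv_left).eq]

/-- The diffeomorphism `I : X_{(g)} → X_{(g⁻¹)}`; for a manifold it is the identity of
`Y_g = Y_{g⁻¹}`. -/
def sectorInv (g : H) : (A.sector g).Hom (A.sector g⁻¹) where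
  obj := A.invObj g
  arr q := ⟨invCent g q.1,
    ⟨((A.invObj g q.2.1.1.1, A.invObj g q.2.1.1.2), q.2.1.2), A.isFixedArr_invObj g q.2.2⟩⟩
  continuous_obj := A.continuous_invObj g
  continuous_arr := continuous_sigma fun h =>
    (continuous_sigmaMk (σ := fun _ : cent (fun _ : Fin 1 => g⁻¹) =>
      (A.fixedLocus fun _ : Fin 1 => g⁻¹).Arr) (i := invCent g h)).comp (Continuous.subtype_mk
    ((((A.continuous_invObj g).comp (A.fixedLocus _).continuous_src).prodMk
      ((A.continuous_invObj g).comp (A.fixedLocus _).continuous_tgt)).prodMk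
      (continuous_snd.comp continuous_subtype_val)) _)
  src_arr _ := rfl
  tgt_arr q := A.invObj_move g q.1 _
  arr_unit _ := rfl
  arr_comp q r _ := by
    refine Sigma.ext rfl (heq_of_eq (Subtype.ext (Prod.ext (Prod.ext rfl ?_) rfl)))
    exact (A.invObj_move g q.1⁻¹ _).symm

/-- The inclusion `Y_{g_1} ∩ ⋯ ∩ Y_{g_k} ⊆ Y_{g_i}`. -/
def evalObj (g : ι → H) (i : ι) (p : A.FixedObj g) : A.FixedObj fun _ : Fin 1 => g i :=
  ⟨(p.1.1, fun _ => p.1.2 i), fun _ => p.2 i⟩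

theorem continuous_evalObj (g : ι → H) (i : ι) : Continuous (A.evalObj g i) :=
  A.continuous_fixed_mk (A.continuous_fixed_base _) fun _ => A.continuous_fixed_arr _ i

/-- The inclusion `C(g_1, …, g_k) ⊆ C(g_i)`. -/
def evalCent (g : ι → H) (i : ι) (h : cent g) : cent fun _ : Fin 1 => g i :=
  ⟨h, Subgroup.mem_centralizer_iff.2 (by
    rintro _ ⟨_, rfl⟩
    exact cent_comm h i)⟩

/-- The evaluation map `e_i : X_{(g_1, …, g_k)} → X_{(g_i)}`, induced by the inclusions
`Y_{g_1} ∩ ⋯ ∩ Y_{g_k} ⊆ Y_{g_i}` and `C(g_1, …, g_k) ⊆ C(g_i)`. -/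
def eval (g : ι → H) (i : ι) : (A.multiSector g).Hom (A.sector (g i)) where
  obj := A.evalObj g i
  arr q := ⟨evalCent g i q.1, ⟨((A.evalObj g i q.2.1.1.1, A.evalObj g i q.2.1.1.2), q.2.1.2),
    q.2.2.1, q.2.2.2.1, fun _ => q.2.2.2.2 i⟩⟩
  continuous_obj := A.continuous_evalObj g i
  continuous_arr := continuous_sigma fun h =>
    (continuous_sigmaMk (σ := fun _ : cent (fun _ : Fin 1 => g i) =>
      (A.fixedLocus fun _ : Fin 1 => g i).Arr) (i := evalCent g i h)).comp (Continuous.subtype_mk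
    ((((A.continuous_evalObj g i).comp (A.fixedLocus _).continuous_src).prodMk
      ((A.continuous_evalObj g i).comp (A.fixedLocus _).continuous_tgt)).prodMk
      (continuous_snd.comp continuous_subtype_val)) _)
  src_arr _ := rfl
  tgt_arr _ := rfl
  arr_unit _ := rfl
  arr_comp _ _ _ := rfl

end GroupoidAction

/-! ## Flat complex orbifold line bundles -/

/-- A flat complex orbifold line bundle over (the orbifold presented by) a topological groupoid:
a family of complex lines over the objects with a flat structure (a cover by open sets with
trivializations whose transition functions are locally constant) and a functorial, linear action
of the arrows on the fibres which is locally constant in these trivializations. -/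
structure FlatLineBundle (Z : TopGroupoid.{u, v}) where
  fiber : Z.Obj → Type
  [addCommGroup : ∀ x, AddCommGroup (fiber x)]
  [module : ∀ x, Module ℂ (fiber x)]
  /-- Labels of the local trivializations. -/
  Chart : Type u
  dom : Chart → Set Z.Obj
  isOpen_dom : ∀ i, IsOpen (dom i)
  cover : ∀ x, ∃ i, x ∈ dom i
  /-- The local trivializations; only the values of `triv i` at points of `dom i` matter. -/
  triv : ∀ (_ : Chart) (x : Z.Obj), fiber x ≃ₗ[ℂ] ℂ
  transition : ∀ i j x, x ∈ dom i → x ∈ dom j →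
    ∃ c : ℂ, ∀ᶠ y in 𝓝 x, ∀ v, triv j y v = c * triv i y v
  act : ∀ (a : Z.Arr) {x y : Z.Obj}, Z.src a = x → Z.tgt a = y → (fiber x →ₗ[ℂ] fiber y)
  act_unit : ∀ x v, act (Z.unit x) (Z.src_unit x) (Z.tgt_unit x) v = v
  act_comp : ∀ a b (e : Z.tgt a = Z.src b) v,
    act (Z.comp a b e) (Z.src_comp a b e) (Z.tgt_comp a b e) v = act b rfl rfl (act a rfl e v)
  act_locallyConstant : ∀ a i j, Z.src a ∈ dom i → Z.tgt a ∈ dom j →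
    ∃ c : ℂ, ∀ᶠ b in 𝓝 a, ∀ v, triv j (Z.tgt b) (act b rfl rfl v) = c * triv i (Z.src b) v

attribute [instance] FlatLineBundle.addCommGroup FlatLineBundle.module

namespace FlatLineBundle

variable {Z W : TopGroupoid.{u, v}}

theorem act_congr (L : FlatLineBundle Z) {a b : Z.Arr} (e : a = b) {x y : Z.Obj}
    (hx : Z.src a = x) (hy : Z.tgt a = y) (hx' : Z.src b = x) (hy' : Z.tgt b = y)
    (v : L.fiber x) : L.act a hx hy v = L.act b hx' hy' v := by
  subst e; rfl

theorem act_comp' (L : FlatLineBundle Z) (a b : Z.Arr) (e : Z.tgt a = Z.src b) {x y z : Z.Obj}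
    (hx : Z.src a = x) (hy : Z.tgt a = y) (hy' : Z.src b = y) (hz : Z.tgt b = z)
    (hc : Z.src (Z.comp a b e) = x) (hc' : Z.tgt (Z.comp a b e) = z) (v : L.fiber x) :
    L.act (Z.comp a b e) hc hc' v = L.act b hy' hz (L.act a hx hy v) := by
  obtain rfl := hx
  obtain rfl := hy'
  obtain rfl := hz
  exact L.act_comp a b e v

theorem act_unit' (L : FlatLineBundle Z) (x x' : Z.Obj) (e : x' = x) (h : Z.src (Z.unit x') = x)
    (h' : Z.tgt (Z.unit x') = x) (v : L.fiber x) : L.act (Z.unit x') h h' v = v := by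
  subst e
  exact L.act_unit _ v

theorem act_inv_act (L : FlatLineBundle Z) (a : Z.Arr) {x y : Z.Obj} (hx : Z.src a = x)
    (hy : Z.tgt a = y) (hy' : Z.src (Z.inv a) = y) (hx' : Z.tgt (Z.inv a) = x) (v : L.fiber x) :
    L.act (Z.inv a) hy' hx' (L.act a hx hy v) = v := by
  rw [← L.act_comp' a (Z.inv a) (by simp) hx hy hy' hx' (by simp [hx]) (by simp [hx])]
  rw [L.act_congr (Z.comp_inv a) _ _ (by simp [hx]) (by simp [hx])]
  exact L.act_unit' _ _ hx _ _ v

theorem act_act_inv (L : FlatLineBundle Z) (a : Z.Arr) {x y : Z.Obj} (hx : Z.src a = x)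
    (hy : Z.tgt a = y) (hy' : Z.src (Z.inv a) = y) (hx' : Z.tgt (Z.inv a) = x) (v : L.fiber y) :
    L.act a hx hy (L.act (Z.inv a) hy' hx' v) = v := by
  rw [← L.act_comp' (Z.inv a) a (by simp) hy' hx' hx hy (by simp [hy]) (by simp [hy])]
  rw [L.act_congr (Z.inv_comp a) _ _ (by simp [hy]) (by simp [hy])]
  exact L.act_unit' _ _ hy _ _ v

/-- An isomorphism of flat orbifold line bundles over the identity of the base: linear
isomorphisms of the fibres, compatible with the arrows and locally constant in flat
trivializations. -/
structure Iso (L M : FlatLineBundle Z) where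
  lin : ∀ x, L.fiber x ≃ₗ[ℂ] M.fiber x
  lin_act : ∀ (a : Z.Arr) v,
    lin (Z.tgt a) (L.act a rfl rfl v) = M.act a rfl rfl (lin (Z.src a) v)
  locallyConstant : ∀ i j x, x ∈ L.dom i → x ∈ M.dom j →
    ∃ c : ℂ, ∀ᶠ y in 𝓝 x, ∀ v, M.triv j y (lin y v) = c * L.triv i y v

/-- The trivial flat line bundle. -/
noncomputable def trivial (Z : TopGroupoid.{u, v}) : FlatLineBundle Z where
  fiber _ := ℂ
  Chart := PUnit
  dom _ := Set.univ
  isOpen_dom _ := isOpen_univ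
  cover _ := ⟨PUnit.unit, Set.mem_univ _⟩
  triv _ _ := LinearEquiv.refl ℂ ℂ
  transition _ _ _ _ _ := ⟨1, by simp⟩
  act _ _ _ _ _ := LinearMap.id
  act_unit _ _ := rfl
  act_comp _ _ _ _ := rfl
  act_locallyConstant _ _ _ _ _ := ⟨1, by simp⟩

/-- The pullback `φ^* L`. -/
noncomputable def pullback (L : FlatLineBundle W) (φ : Z.Hom W) : FlatLineBundle Z where
  fiber x := L.fiber (φ.obj x)
  Chart := L.Chart
  dom i := φ.obj ⁻¹' L.dom i
  isOpen_dom i := (L.isOpen_dom i).preimage φ.continuous_obj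
  cover x := L.cover (φ.obj x)
  triv i x := L.triv i (φ.obj x)
  transition i j x hi hj := by
    obtain ⟨c, hc⟩ := L.transition i j (φ.obj x) hi hj
    exact ⟨c, φ.continuous_obj.continuousAt.eventually hc⟩
  act a _ _ hx hy := L.act (φ.arr a) ((φ.src_arr a).trans (congrArg φ.obj hx))
    ((φ.tgt_arr a).trans (congrArg φ.obj hy))
  act_unit x v := by
    have := L.act_unit (φ.obj x) v
    simpa only [φ.arr_unit] using this
  act_comp a b e v := by
    have h : W.tgt (φ.arr a) = W.src (φ.arr b) := by rw [φ.tgt_arr, φ.src_arr, e]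
    exact (L.act_congr (φ.arr_comp a b e) _ _ (by simp [φ.src_arr]) (by simp [φ.tgt_arr]) v).trans
      (L.act_comp' (φ.arr a) (φ.arr b) h (φ.src_arr a) (h.trans (φ.src_arr b)) (φ.src_arr b)
        (φ.tgt_arr b) _ _ v)
  act_locallyConstant a i j hi hj := by
    obtain ⟨c, hc⟩ := L.act_locallyConstant (φ.arr a) i j
      (by rw [φ.src_arr]; exact hi) (by rw [φ.tgt_arr]; exact hj)
    refine ⟨c, ?_⟩
    filter_upwards [φ.continuous_arr.continuousAt.eventually hc] with b hb v
    have key : ∀ (x y : W.Obj) (hx : W.src (φ.arr b) = x) (hy : W.tgt (φ.arr b) = y)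
        (v : L.fiber x), L.triv j y (L.act (φ.arr b) hx hy v) = c * L.triv i x v := by
      rintro _ _ rfl rfl v
      exact hb v
    exact key _ _ (φ.src_arr b) (φ.tgt_arr b) v

/-- The tensor product `L ⊗ M`. -/
noncomputable def tensor (L M : FlatLineBundle Z) : FlatLineBundle Z where
  fiber x := L.fiber x ⊗[ℂ] M.fiber x
  Chart := L.Chart × M.Chart
  dom i := L.dom i.1 ∩ M.dom i.2
  isOpen_dom i := (L.isOpen_dom i.1).inter (M.isOpen_dom i.2)
  cover x := by
    obtain ⟨i, hi⟩ := L.cover x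
    obtain ⟨j, hj⟩ := M.cover x
    exact ⟨(i, j), hi, hj⟩
  triv i x := (TensorProduct.congr (L.triv i.1 x) (M.triv i.2 x)).trans (TensorProduct.lid ℂ ℂ)
  transition i j x hi hj := by
    obtain ⟨c, hc⟩ := L.transition i.1 j.1 x hi.1 hj.1
    obtain ⟨d, hd⟩ := M.transition i.2 j.2 x hi.2 hj.2
    refine ⟨c * d, ?_⟩
    filter_upwards [hc, hd] with y h1 h2 v
    induction v with
    | zero => simp
    | add a b ha hb => simp only [map_add, ha, hb, mul_add]
    | tmul a b => simp [h1, h2]; ring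
  act a _ _ hx hy := TensorProduct.map (L.act a hx hy) (M.act a hx hy)
  act_unit x v := by
    induction v with
    | zero => simp
    | add a b ha hb => simp only [map_add, ha, hb]
    | tmul a b => simp [L.act_unit, M.act_unit]
  act_comp a b e v := by
    induction v with
    | zero => simp
    | add a b ha hb => simp only [map_add, ha, hb]
    | tmul a b => simp [L.act_comp, M.act_comp]
  act_locallyConstant a i j hi hj := by
    obtain ⟨c, hc⟩ := L.act_locallyConstant a i.1 j.1 hi.1 hj.1
    obtain ⟨d, hd⟩ := M.act_locallyConstant a i.2 j.2 hi.2 hj.2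
    refine ⟨c * d, ?_⟩
    filter_upwards [hc, hd] with y h1 h2 v
    induction v with
    | zero => simp
    | add a b ha hb => simp only [map_add, ha, hb, mul_add]
    | tmul a b => simp [h1, h2]; ring

/-- The inverse `L⁻¹`, i.e. the dual line bundle: arrows act by the inverse transpose. -/
noncomputable def dual (L : FlatLineBundle Z) : FlatLineBundle Z where
  fiber x := Module.Dual ℂ (L.fiber x)
  Chart := L.Chart
  dom := L.dom
  isOpen_dom := L.isOpen_dom
  cover := L.cover
  triv i x := (L.triv i x).symm.dualMap.trans (LinearMap.ringLmapEquivSelf ℂ ℂ ℂ)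
  transition i j x hi hj := by
    obtain ⟨c, hc⟩ := L.transition j i x hj hi
    refine ⟨c, ?_⟩
    filter_upwards [hc] with y h v
    have e : (L.triv j y).symm 1 = c • (L.triv i y).symm 1 := by
      apply (L.triv i y).injective
      rw [h]
      simp
    simp [e]
  act a _ _ hx hy := (L.act (Z.inv a) ((Z.src_inv a).trans hy) ((Z.tgt_inv a).trans hx)).dualMap
  act_unit x v := by
    ext w
    simp only [LinearMap.dualMap_apply]
    congr 1
    have := L.act_inv_act (Z.unit x) (Z.src_unit x) (Z.tgt_unit x) (by simp) (by simp) w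
    rwa [L.act_unit x w] at this
  act_comp a b e v := by
    ext w
    simp only [LinearMap.dualMap_apply]
    congr 1
    have h1 := L.act_act_inv b rfl rfl (by simp) (by simp) w
    have h2 := L.act_act_inv a rfl e ((Z.src_inv a).trans e) (by simp)
      (L.act (Z.inv b) (by simp) (by simp) w)
    conv_lhs => rw [← h1, ← h2]
    rw [← L.act_comp' a b e rfl e rfl rfl (by simp) (by simp), L.act_inv_act]
  act_locallyConstant a i j hi hj := by
    obtain ⟨c, hc⟩ := L.act_locallyConstant a i j hi hj
    refine ⟨c⁻¹, ?_⟩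
    filter_upwards [hc] with b hb v
    have h1 : L.act b rfl rfl ((L.triv i (Z.src b)).symm 1) =
        c • (L.triv j (Z.tgt b)).symm 1 := by
      apply (L.triv j (Z.tgt b)).injective
      rw [hb]
      simp
    have h2 : (L.triv i (Z.src b)).symm 1 =
        c • L.act (Z.inv b) (by simp) (by simp) ((L.triv j (Z.tgt b)).symm 1) := by
      rw [← map_smul, ← h1, L.act_inv_act]
    have hc0 : c ≠ 0 := by
      rintro rfl
      rw [zero_smul] at h2
      have := congrArg (L.triv i (Z.src b)) h2
      simp at this
    simp [h2, hc0]

/-- The product `L_1 ⊗ ⋯ ⊗ L_k` of a list of line bundles. -/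
noncomputable def prod (l : List (FlatLineBundle Z)) : FlatLineBundle Z :=
  l.foldr tensor (trivial Z)

/-- The flat orbifold line bundle `Z ×_χ ℂ` over `Z/H` associated to a character `χ : H → U(1)`:
the quotient of `Z × ℂ` by `h (z, v) = (hz, χ(h) v)`. -/
noncomputable def assoc {H : Type w} [Group H] (A : GroupoidAction H Z) (χ : H →* Circle) :
    FlatLineBundle A.quotient where
  fiber _ := ℂ
  Chart := PUnit
  dom _ := Set.univ
  isOpen_dom _ := isOpen_univ
  cover _ := ⟨PUnit.unit, Set.mem_univ _⟩
  triv _ _ := LinearEquiv.refl ℂ ℂ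
  transition _ _ _ _ _ := ⟨1, by simp⟩
  act q _ _ _ _ := ((χ q.1 : Circle) : ℂ) • LinearMap.id
  act_unit _ v := by
    change ((χ 1 : Circle) : ℂ) * v = v
    simp
  act_comp q r _ v := by
    change ((χ (r.1 * q.1) : Circle) : ℂ) * v = (χ r.1 : ℂ) * ((χ q.1 : ℂ) * v)
    simp [mul_assoc]
  act_locallyConstant q _ _ _ _ := by
    refine ⟨(χ q.1 : ℂ), ?_⟩
    filter_upwards [(isLocallyConstant_fst (H := H) (X := Z.Arr)).eventually_eq q] with r hr v
    change ((χ r.1 : Circle) : ℂ) * v = (χ q.1 : ℂ) * v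
    rw [hr]

end FlatLineBundle

/-! ## The line bundles of a discrete torsion -/

section

variable {G : Type w} [Group G] {Y : TopGroupoid.{u, v}} (A : GroupoidAction G Y) (α : H2 G)

open GroupoidAction

theorem cent_le_singleton (g : G) :
    cent (fun _ : Fin 1 => g) ≤ Subgroup.centralizer {g} :=
  Subgroup.centralizer_le (by rintro _ rfl; exact ⟨0, rfl⟩)

theorem cent_le_prod {k : ℕ} (g : Fin k → G) :
    cent g ≤ Subgroup.centralizer {(List.ofFn g).prod} := fun h hh =>
  Subgroup.mem_centralizer_singleton_iff.2 (Commute.list_prod_right _ h fun x hx => by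
    obtain ⟨i, rfl⟩ := (List.mem_ofFn' _ _).1 hx
    exact (cent_comm ⟨h, hh⟩ i).symm).eq

/-- `L_g = Y_g ×_{L^α_g} ℂ` over `X_{(g)} = Y_g / C(g)`. -/
noncomputable def lineBundle (g : G) : FlatLineBundle (A.sector g) :=
  FlatLineBundle.assoc (A.fixedAction fun _ : Fin 1 => g)
    ((twistedChar α g).comp (Subgroup.inclusion (cent_le_singleton g)))

/-- `L_{(g_1, …, g_k)} = (Y_{g_1} ∩ ⋯ ∩ Y_{g_k}) ×_{γ_{g_1 ⋯ g_k}} ℂ` over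
`X_{(g_1, …, g_k)} = (Y_{g_1} ∩ ⋯ ∩ Y_{g_k}) / C(g_1, …, g_k)`. -/
noncomputable def multiLineBundle {k : ℕ} (g : Fin k → G) : FlatLineBundle (A.multiSector g) :=
  FlatLineBundle.assoc (A.fixedAction g)
    ((twistedChar α (List.ofFn g).prod).comp (Subgroup.inclusion (cent_le_prod g)))

end

end DiscreteTorsion

namespace DiscreteTorsion

universe u v w

/-! ## Properties of the phase -/

/-! Every bundle in the statement is built from bundles `assoc A χ`, whose fibres are all `ℂ` and on
which an arrow acts through the value of a character on its group component. An isomorphism between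
such bundles, or their pullbacks, therefore comes down to an identity of characters, with the
identity of `ℂ` (or evaluation at `1`, or `v ↦ 1 ⊗ v`) as the map on fibres.

Writing γ_g for the twisted character, the three identities are γ_{tgt⁻¹}(tht⁻¹) = γ_g(h)
(`twistedChar_conj`), γ_{g⁻¹} = γ_g⁻¹ (`twistedChar_inv`), and γ_{g_1⋯g_k} = γ_{g_1}⋯γ_{g_k} on the
common centralizer (`twistedChar_list_prod`). The last two hold because the phase is antisymmetric
and multiplicative in each variable on commuting pairs. The first holds because conjugation changes
a cocycle only by a coboundary, which the phase of a commuting pair does not see.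

What remains is that the maps of sectors are isomorphisms of topological groupoids
(`translate_isIso`, `sectorInv_isIso`). This is shown by explicit continuous inverses: translation
by t⁻¹, and the inversion map for g⁻¹. -/

theorem phase_swap {G : Type v} (α : G → G → Circle) (g h : G) :
    phase α g h = (phase α h g)⁻¹ := by
  simp [phase]

section Phase

variable {G : Type v} [Group G]

/-- Antisymmetry turns this into multiplicativity in the second variable. Only k has to commute with
g and h; these two need not commute with each other. -/
theorem phase_mul_left {α : G → G → Circle} (hα : α ∈ Z2 G) {g h k : G}
    (hgk : g * k = k * g) (hhk : h * k = k * h) :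
    phase α (g * h) k = phase α g k * phase α h k := by
  rw [phase_swap, phase_mul_right hα hgk.symm hhk.symm, phase_swap α g, phase_swap α h, mul_inv]

/-- A cocycle and its conjugate by `t` differ by the coboundary of
`g ↦ α_{t,g} α_{tgt⁻¹,t}⁻¹`. -/
theorem cocycle_conj {α : G → G → Circle} (hα : α ∈ Z2 G) (t g h : G) :
    α g h * (α t (g * h) * (α (t * (g * h) * t⁻¹) t)⁻¹) =
      α (t * g * t⁻¹) (t * h * t⁻¹) * ((α t g * (α (t * g * t⁻¹) t)⁻¹) *
        (α t h * (α (t * h * t⁻¹) t)⁻¹)) := by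
  -- The three instances of the cocycle identity carry t through the word from left to right: t·g·h
  -- = (tgt⁻¹)·t·h = (tgt⁻¹)·(tht⁻¹)·t.
  have e1 := hα.2 t g h
  have e2 := hα.2 (t * g * t⁻¹) t h
  have e3 := hα.2 (t * g * t⁻¹) (t * h * t⁻¹) t
  rw [inv_mul_cancel_right] at e2 e3
  have hp : t * g * t⁻¹ * (t * h * t⁻¹) = t * (g * h) * t⁻¹ := by group
  rw [hp] at e3
  have f1 : α t (g * h) * α g h = α t g * α (t * g) h := e1
  have f2 : α (t * g) h = (α (t * g * t⁻¹) t)⁻¹ * (α (t * g * t⁻¹) (t * h) * α t h) := by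
    rw [e2]; group
  have f3 : α (t * g * t⁻¹) (t * h) =
      α (t * g * t⁻¹) (t * h * t⁻¹) * α (t * (g * h) * t⁻¹) t * (α (t * h * t⁻¹) t)⁻¹ := by
    rw [← e3]; group
  rw [← mul_assoc, mul_comm (α g h), f1, f2, f3]
  -- The one pair of factors that cancels is set apart, so that the rest is a mere rearrangement.
  trans α (t * g * t⁻¹) (t * h * t⁻¹) * ((α t g * (α (t * g * t⁻¹) t)⁻¹) *
        (α t h * (α (t * h * t⁻¹) t)⁻¹)) *
        (α (t * (g * h) * t⁻¹) t * (α (t * (g * h) * t⁻¹) t)⁻¹)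
  · ac_rfl
  · simp

/-- Divide `cocycle_conj` for (g, h) by the same identity for (h, g). Since gh = hg, the factor at
the product is the same in both, and the correction factors at g and h are symmetric, so only the
two phases survive. -/
theorem phase_conj {α : G → G → Circle} (hα : α ∈ Z2 G) (t : G) {g h : G}
    (hgh : g * h = h * g) :
    phase α (t * g * t⁻¹) (t * h * t⁻¹) = phase α g h := by
  have e1 := cocycle_conj hα t g h
  have e2 := cocycle_conj hα t h g
  rw [← hgh, mul_comm (α t h * _)] at e2
  have e := congrArg₂ (· / ·) e1 e2
  simp only [mul_div_mul_right_eq_div] at e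
  simpa only [phase, ← div_eq_mul_inv] using e.symm

end Phase

/-! ## Properties of the twisted characters -/

section TwistedChar

variable {G : Type v} [Group G]

/-- The argument h' is any element of the centralizer with the right value in G, so the lemma
applies whatever the proof of membership. On a representing cocycle `twistedChar` unfolds to the
phase. -/
theorem twistedChar_conj (α : H2 G) (t g : G) (h : Subgroup.centralizer {g})
    (h' : Subgroup.centralizer {t * g * t⁻¹}) (e : (h' : G) = t * h * t⁻¹) :
    twistedChar α (t * g * t⁻¹) h' = twistedChar α g h := by
  induction α using QuotientGroup.induction_on with
  | H a =>
    change phase a.1 (t * g * t⁻¹) h' = phase a.1 g h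
    rw [e, phase_conj a.2 t (Subgroup.mem_centralizer_singleton_iff.1 h.2).symm]

theorem twistedChar_one (α : H2 G) (h : Subgroup.centralizer {(1 : G)}) :
    twistedChar α 1 h = 1 := by
  induction α using QuotientGroup.induction_on with
  | H a =>
    change phase a.1 1 h = 1
    simp [phase, a.2.1]

/-- The arguments are one element of G seen in three centralizers; the equations e₁ and e₂ replace
coercions between these subgroups. -/
theorem twistedChar_mul (α : H2 G) {g₁ g₂ : G} (h : Subgroup.centralizer {g₁ * g₂})
    (h₁ : Subgroup.centralizer {g₁}) (h₂ : Subgroup.centralizer {g₂}) (e₁ : (h₁ : G) = h)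
    (e₂ : (h₂ : G) = h) :
    twistedChar α (g₁ * g₂) h = twistedChar α g₁ h₁ * twistedChar α g₂ h₂ := by
  induction α using QuotientGroup.induction_on with
  | H a =>
    change phase a.1 (g₁ * g₂) h = phase a.1 g₁ h₁ * phase a.1 g₂ h₂
    have c₁ := (Subgroup.mem_centralizer_singleton_iff.1 h₁.2).symm
    have c₂ := (Subgroup.mem_centralizer_singleton_iff.1 h₂.2).symm
    rw [e₁] at c₁ ⊢
    rw [e₂] at c₂ ⊢
    exact phase_mul_left a.2 c₁ c₂

/-- The domain of the character depends on g, so an equality of group elements cannot simply be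
rewritten under it. -/
theorem twistedChar_congr (α : H2 G) {g g' : G} (e : g = g') (h : Subgroup.centralizer {g})
    (h' : Subgroup.centralizer {g'}) (eh : (h : G) = h') :
    twistedChar α g h = twistedChar α g' h' := by
  subst e
  rw [Subtype.ext eh]

/-- Multiplicativity at g g⁻¹ = 1, together with the triviality of the character of 1. -/
theorem twistedChar_inv (α : H2 G) (g : G) (h : Subgroup.centralizer {g})
    (h' : Subgroup.centralizer {g⁻¹}) (e : (h' : G) = h) :
    twistedChar α g⁻¹ h' = (twistedChar α g h)⁻¹ := by
  have h₁ : (h : G) ∈ Subgroup.centralizer {g * g⁻¹} := by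
    simp [Subgroup.mem_centralizer_singleton_iff]
  have h₂ : (h : G) ∈ Subgroup.centralizer {(1 : G)} := by
    simp [Subgroup.mem_centralizer_singleton_iff]
  rw [eq_inv_iff_mul_eq_one, mul_comm, ← twistedChar_mul α ⟨h, h₁⟩ h h' rfl e,
    twistedChar_congr α (mul_inv_cancel g) _ ⟨h, h₂⟩ rfl, twistedChar_one]

theorem twistedChar_list_prod (α : H2 G) {k : ℕ} (g : Fin k → G) (x : G)
    (h : x ∈ Subgroup.centralizer {(List.ofFn g).prod})
    (hi : ∀ i, x ∈ Subgroup.centralizer {g i}) :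
    twistedChar α (List.ofFn g).prod ⟨x, h⟩ =
      (List.ofFn fun i => twistedChar α (g i) ⟨x, hi i⟩).prod := by
  induction k with
  | zero =>
    have h₁ : x ∈ Subgroup.centralizer {(1 : G)} := by
      simp [Subgroup.mem_centralizer_singleton_iff]
    rw [twistedChar_congr α (by simp) ⟨x, h⟩ ⟨x, h₁⟩ rfl, twistedChar_one]
    simp
  | succ k ih =>
    -- An element commuting with each remaining factor commutes with their product, as the induction
    -- hypothesis requires.
    have ht : x ∈ Subgroup.centralizer {(List.ofFn fun i : Fin k => g i.succ).prod} :=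
      Subgroup.mem_centralizer_singleton_iff.2 (Commute.list_prod_right _ x fun y hy => by
        obtain ⟨i, rfl⟩ := (List.mem_ofFn' _ _).1 hy
        exact Subgroup.mem_centralizer_singleton_iff.1 (hi i.succ)).eq
    have hm : x ∈ Subgroup.centralizer {g 0 * (List.ofFn fun i : Fin k => g i.succ).prod} := by
      simpa [List.ofFn_succ] using h
    rw [twistedChar_congr α (by rw [List.ofFn_succ, List.prod_cons]) ⟨x, h⟩ ⟨x, hm⟩ rfl,
      twistedChar_mul α ⟨x, hm⟩ ⟨x, hi 0⟩ ⟨x, ht⟩ rfl rfl, ih _ ht fun i => hi i.succ]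
    simp [List.ofFn_succ]

end TwistedChar

/-! ## Isomorphisms of associated line bundles -/

namespace FlatLineBundle

section

variable {H K : Type w} [Group H] [Group K] {Z W : TopGroupoid.{u, v}}

/-- A groupoid homomorphism compatible with the characters induces, by the identity of `ℂ`, an
isomorphism of an associated line bundle with the pullback of another one. -/
noncomputable def assocPullbackIso (A : GroupoidAction H Z) (B : GroupoidAction K W)
    (χ : H →* Circle) (ψ : K →* Circle) (φ : A.quotient.Hom B.quotient)
    (hφ : ∀ q : A.quotient.Arr, ψ (φ.arr q).1 = χ q.1) :
    Iso (assoc A χ) ((assoc B ψ).pullback φ) where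
  lin _ := LinearEquiv.refl ℂ ℂ
  lin_act q (v : ℂ) := by
    change ((χ q.1 : Circle) : ℂ) * v = ((ψ (φ.arr q).1 : Circle) : ℂ) * v
    rw [hφ]
  -- Both bundles have a single global trivialization, in which the map is the identity.
  locallyConstant _ _ _ _ _ := ⟨1, Filter.Eventually.of_forall fun _ (v : ℂ) => (one_mul v).symm⟩

/-- The dual of an associated line bundle is isomorphic to the pullback of an associated line
bundle along a groupoid homomorphism that inverts the characters. -/
noncomputable def assocDualIso (A : GroupoidAction H Z) (B : GroupoidAction K W)
    (χ : H →* Circle) (ψ : K →* Circle) (φ : A.quotient.Hom B.quotient)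
    (hφ : ∀ q : A.quotient.Arr, ψ (φ.arr q).1 = (χ q.1)⁻¹) :
    Iso (assoc A χ).dual ((assoc B ψ).pullback φ) where
  lin _ := LinearMap.ringLmapEquivSelf ℂ ℂ ℂ
  lin_act q (v : ℂ →ₗ[ℂ] ℂ) := by
    -- A functional is identified with its value at 1. On the dual, q acts by precomposition with
    -- the inverse arrow, whose group component is `q.1⁻¹`; linearity then pulls out χ(q)⁻¹.
    change v (((χ q.1⁻¹ : Circle) : ℂ) • (1 : ℂ)) =
      ((ψ (φ.arr q).1 : Circle) : ℂ) * v 1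
    rw [hφ, map_smul, map_inv, smul_eq_mul]
  locallyConstant _ _ _ _ _ :=
    ⟨1, Filter.Eventually.of_forall fun _ (v : ℂ →ₗ[ℂ] ℂ) => (one_mul (v 1)).symm⟩

/-- The line bundle associated to the trivial character is trivial. -/
noncomputable def assocOneIso (A : GroupoidAction H Z) :
    Iso (assoc A 1) (trivial A.quotient) where
  lin _ := LinearEquiv.refl ℂ ℂ
  lin_act q (v : ℂ) := by
    change (((1 : H →* Circle) q.1 : Circle) : ℂ) * v = v
    simp
  locallyConstant _ _ _ _ _ := ⟨1, Filter.Eventually.of_forall fun _ (v : ℂ) => (one_mul v).symm⟩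

/-- The line bundle associated to a product of characters is the tensor product. -/
noncomputable def assocMulIso (A : GroupoidAction H Z) (χ ψ : H →* Circle)
    {L M : FlatLineBundle A.quotient} (Φ : Iso (assoc A χ) L) (Ψ : Iso (assoc A ψ) M) :
    Iso (assoc A (χ * ψ)) (tensor L M) where
  -- This map sends v to Φ(1) ⊗ Ψ(v).
  lin x := (TensorProduct.lid ℂ ℂ).symm.trans (TensorProduct.congr (Φ.lin x) (Ψ.lin x))
  lin_act q (v : ℂ) := by
    have h1 := Φ.lin_act q (1 : ℂ)
    have h2 := Ψ.lin_act q v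
    change Φ.lin _ (1 : ℂ) ⊗ₜ[ℂ] Ψ.lin _ ((((χ * ψ) q.1 : Circle) : ℂ) * v : ℂ) =
      L.act q rfl rfl (Φ.lin _ (1 : ℂ)) ⊗ₜ[ℂ] M.act q rfl rfl (Ψ.lin _ v)
    rw [← h1, ← h2]
    change _ = Φ.lin _ (((χ q.1 : Circle) : ℂ) • (1 : ℂ)) ⊗ₜ[ℂ]
      Ψ.lin _ (((ψ q.1 : Circle) : ℂ) * v : ℂ)
    have e1 : Φ.lin (A.quotient.tgt q) (((χ q.1 : Circle) : ℂ) • (1 : ℂ)) =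
      ((χ q.1 : Circle) : ℂ) • Φ.lin (A.quotient.tgt q) (1 : ℂ) := (Φ.lin _).map_smul _ _
    -- The product χψ acts entirely on the second factor here, so its χ part is split off in order
    -- to be moved across the tensor sign.
    have e2 : Ψ.lin (A.quotient.tgt q) ((((χ * ψ) q.1 : Circle) : ℂ) * v : ℂ) =
        ((χ q.1 : Circle) : ℂ) • Ψ.lin (A.quotient.tgt q) (((ψ q.1 : Circle) : ℂ) * v : ℂ) := by
      rw [MonoidHom.mul_apply, Circle.coe_mul, mul_assoc]
      exact (Ψ.lin _).map_smul _ (((ψ q.1 : Circle) : ℂ) * v : ℂ)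
    rw [e1, e2, TensorProduct.tmul_smul, TensorProduct.smul_tmul']
  locallyConstant i j x hi hj := by
    obtain ⟨c, hc⟩ := Φ.locallyConstant i j.1 x hi hj.1
    obtain ⟨d, hd⟩ := Ψ.locallyConstant i j.2 x hi hj.2
    refine ⟨c * d, ?_⟩
    filter_upwards [hc, hd] with y h1 h2 (v : ℂ)
    change L.triv j.1 y (Φ.lin y (1 : ℂ)) * M.triv j.2 y (Ψ.lin y v) = c * d * v
    refine (congrArg₂ (· * ·) (h1 (1 : ℂ)) (h2 v)).trans ?_
    change c * (1 : ℂ) * (d * v) = c * d * v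
    ring

/-- Induction on k. Since `assocMulIso` accepts arbitrary bundles isomorphic to the associated ones,
no composition of isomorphisms is needed. Claiming mere existence allows rewriting along equalities
of lists without casts in the data. -/
theorem nonempty_assocProdIso (A : GroupoidAction H Z) {k : ℕ} (χ : Fin k → H →* Circle)
    (L : Fin k → FlatLineBundle A.quotient) (Φ : ∀ i, Nonempty (Iso (assoc A (χ i)) (L i))) :
    Nonempty (Iso (assoc A (List.ofFn χ).prod) (prod (List.ofFn L))) := by
  induction k with
  | zero => simpa [prod] using ⟨assocOneIso A⟩
  | succ k ih =>
    obtain ⟨Φ₀⟩ := Φ 0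
    obtain ⟨Ψ⟩ := ih (fun i => χ i.succ) (fun i => L i.succ) fun i => Φ i.succ
    rw [List.ofFn_succ, List.ofFn_succ, List.prod_cons]
    exact ⟨assocMulIso A _ _ Φ₀ Ψ⟩

end

end FlatLineBundle

/-! ## The isomorphisms of sectors -/

namespace GroupoidAction

variable {H : Type w} [Group H] {Z : TopGroupoid.{u, v}} (A : GroupoidAction H Z)

/-- Stated for any s, t with st = 1, so that it covers both composites of translation by t and by
t⁻¹. -/
theorem moveObj_moveObj {ι : Type} {g g' : ι → H} {s t : H} (hst : s * t = 1)
    (ht : ∀ i, t * g i = g' i * t) (hs : ∀ i, s * g' i = g i * s) (p : A.FixedObj g) :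
    A.moveObj s hs (A.moveObj t ht p) = p := by
  refine Subtype.ext (Prod.ext ?_ (funext fun i => ?_))
  · change A.obj s (A.obj t _) = _
    rw [← A.obj_mul, hst, A.obj_one]
  · change A.arr s (A.arr t _) = _
    rw [← A.arr_mul, hst, A.arr_one]

theorem moveArr_moveArr {ι : Type} {g g' : ι → H} {s t : H} (hst : s * t = 1)
    (ht : ∀ i, t * g i = g' i * t) (hs : ∀ i, s * g' i = g i * s) (q : (A.fixedLocus g).Arr) :
    A.moveArr s hs (A.moveArr t ht q) = q := by
  refine Subtype.ext (Prod.ext (Prod.ext (A.moveObj_moveObj hst ht hs _)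
    (A.moveObj_moveObj hst ht hs _)) ?_)
  change A.arr s (A.arr t _) = _
  rw [← A.arr_mul, hst, A.arr_one]

theorem translate_isIso (t g : H) : (A.translate t g).IsIso := by
  have ht : ∀ _ : Fin 1, t * g = t * g * t⁻¹ * t := fun _ => by group
  -- Because `moveObj` accepts any tuple satisfying this relation, translation by t⁻¹ lands in the
  -- fixed locus of g itself, not in that of t⁻¹(tgt⁻¹)t.
  have hs : ∀ _ : Fin 1, t⁻¹ * (t * g * t⁻¹) = g * t⁻¹ := fun _ => by group
  let inv : cent (fun _ : Fin 1 => t * g * t⁻¹) → cent fun _ : Fin 1 => g := fun h =>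
    ⟨t⁻¹ * h * t, Subgroup.mem_centralizer_iff.2 (by
      rintro _ ⟨i, rfl⟩
      have e : t * g * t⁻¹ * h = h * (t * g * t⁻¹) := cent_comm h i
      calc g * (t⁻¹ * h * t) = t⁻¹ * (t * g * t⁻¹ * h) * t := by group
        _ = t⁻¹ * h * t * g := by rw [e]; group)⟩
  refine ⟨(Homeomorph.mk ⟨A.moveObj t ht, A.moveObj t⁻¹ hs, ?_, ?_⟩
      (A.continuous_moveObj t ht) (A.continuous_moveObj t⁻¹ hs)).isHomeomorph,
    (Homeomorph.mk (X := (A.sector g).Arr) (Y := (A.sector (t * g * t⁻¹)).Arr)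
      ⟨(A.translate t g).arr, fun q => ⟨inv q.1, A.moveArr t⁻¹ hs q.2⟩, ?_, ?_⟩
      (A.translate t g).continuous_arr ?_).isHomeomorph⟩
  · exact A.moveObj_moveObj (inv_mul_cancel t) ht hs
  · exact A.moveObj_moveObj (mul_inv_cancel t) hs ht
  · intro q
    refine Sigma.ext (Subtype.ext ?_)
      (heq_of_eq (A.moveArr_moveArr (inv_mul_cancel t) ht hs q.2))
    change t⁻¹ * (t * (q.1 : H) * t⁻¹) * t = q.1
    group
  · intro q
    refine Sigma.ext (Subtype.ext ?_)
      (heq_of_eq (A.moveArr_moveArr (mul_inv_cancel t) hs ht q.2))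
    change t * (t⁻¹ * (q.1 : H) * t) * t⁻¹ = q.1
    group
  -- The group is discrete, so continuity is checked on the sheet of each h, which goes to the sheet
  -- of t⁻¹ht.
  · exact continuous_sigma fun h =>
      (continuous_sigmaMk (σ := fun _ : cent (fun _ : Fin 1 => g) =>
        (A.fixedLocus fun _ : Fin 1 => g).Arr) (i := inv h)).comp (A.continuous_moveArr t⁻¹ hs)

/-- Bracket (a⁻¹)⁻¹ a⁻¹ a in the two possible ways. -/
theorem _root_.DiscreteTorsion.TopGroupoid.inv_inv (Z : TopGroupoid.{u, v}) (a : Z.Arr) :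
    Z.inv (Z.inv a) = a := by
  have e := Z.assoc (Z.inv (Z.inv a)) (Z.inv a) a (by simp) (by simp)
  have u₁ := Z.comp_unit (Z.inv (Z.inv a))
  have u₂ := Z.unit_comp a
  simp only [Z.src_inv, Z.tgt_inv] at u₁
  simp only [Z.inv_comp, Z.tgt_inv] at e
  rw [← u₁, ← e, u₂]

/-- This is the computation g(g⁻¹k⁻¹)⁻¹ = k, by which inverting for g and then for g⁻¹ returns the
arrow k. -/
theorem arr_inv_arr_inv (g : H) (a : Z.Arr) :
    A.arr g (Z.inv (A.arr g⁻¹ (Z.inv a))) = a := by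
  rw [← A.arr_inv_comm, A.arr_arr_inv, Z.inv_inv]

theorem sectorInv_isIso (g : H) : (A.sectorInv g).IsIso := by
  -- The inversion for g⁻¹ lands in the fixed locus of g⁻¹⁻¹, which is not definitionally that of g.
  -- Translation by 1 carries one to the other without a cast.
  have ht : ∀ _ : Fin 1, 1 * g⁻¹⁻¹ = g * 1 := fun _ => by group
  let inv : cent (fun _ : Fin 1 => g⁻¹) → cent fun _ : Fin 1 => g := fun h =>
    ⟨h, by
      have hh := (invCent g⁻¹ h).2
      simp only [inv_inv] at hh
      exact hh⟩
  let F : (A.FixedObj fun _ : Fin 1 => g⁻¹) → A.FixedObj fun _ : Fin 1 => g :=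
    fun p => A.moveObj 1 ht (A.invObj g⁻¹ p)
  have hl : ∀ p, F (A.invObj g p) = p := fun p =>
    Subtype.ext (Prod.ext (A.obj_one _) (funext fun i => by
      change A.arr 1 (A.arr g⁻¹⁻¹ (Z.inv (A.arr g⁻¹ (Z.inv (p.1.2 i))))) = p.1.2 i
      rw [A.arr_one, inv_inv, A.arr_inv_arr_inv]))
  have hr : ∀ p, A.invObj g (F p) = p := fun p =>
    Subtype.ext (Prod.ext (A.obj_one _) (funext fun i => by
      change A.arr g⁻¹ (Z.inv (A.arr 1 (A.arr g⁻¹⁻¹ (Z.inv (p.1.2 i))))) = p.1.2 i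
      rw [A.arr_one, A.arr_inv_arr_inv]))
  refine ⟨(Homeomorph.mk ⟨A.invObj g, F, hl, hr⟩ (A.continuous_invObj g)
      ((A.continuous_moveObj 1 ht).comp (A.continuous_invObj g⁻¹))).isHomeomorph,
    (Homeomorph.mk (X := (A.sector g).Arr) (Y := (A.sector g⁻¹).Arr)
      ⟨(A.sectorInv g).arr,
        fun q => ⟨inv q.1, A.moveArr 1 ht ((A.sectorInv g⁻¹).arr q).2⟩, ?_, ?_⟩
      (A.sectorInv g).continuous_arr ?_).isHomeomorph⟩
  · exact fun q => Sigma.ext rfl (heq_of_eq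
      (Subtype.ext (Prod.ext (Prod.ext (hl _) (hl _)) (A.arr_one _))))
  · exact fun q => Sigma.ext rfl (heq_of_eq
      (Subtype.ext (Prod.ext (Prod.ext (hr _) (hr _)) (A.arr_one _))))
  · exact continuous_sigma fun h =>
      (continuous_sigmaMk (σ := fun _ : cent (fun _ : Fin 1 => g) =>
        (A.fixedLocus fun _ : Fin 1 => g).Arr) (i := inv h)).comp
        ((A.continuous_moveArr 1 ht).comp (continuous_sigma_snd.comp
          ((A.sectorInv g⁻¹).continuous_arr.comp continuous_sigmaMk)))

end GroupoidAction

/-! ## The isomorphisms of line bundles -/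

section

variable {G : Type w} [Group G] {Y : TopGroupoid.{u, v}} (A : GroupoidAction G Y) (α : H2 G)

/-- `t × Id : L_g ≅ L_{tgt⁻¹}`. -/
noncomputable def lineBundleTranslateIso (t g : G) :
    FlatLineBundle.Iso (lineBundle A α g) ((lineBundle A α (t * g * t⁻¹)).pullback
      (A.translate t g)) :=
  FlatLineBundle.assocPullbackIso _ _ _ _ (A.translate t g) fun _ =>
    twistedChar_conj α t g _ _ rfl

/-- `L_g⁻¹ ≅ I^* L_{g⁻¹}`. -/
noncomputable def lineBundleDualIso (g : G) :
    FlatLineBundle.Iso (lineBundle A α g).dual ((lineBundle A α g⁻¹).pullback (A.sectorInv g)) :=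
  FlatLineBundle.assocDualIso _ _ _ _ (A.sectorInv g) fun _ => twistedChar_inv α g _ _ rfl

theorem cent_le_apply {k : ℕ} (g : Fin k → G) (i : Fin k) :
    GroupoidAction.cent g ≤ Subgroup.centralizer {g i} :=
  Subgroup.centralizer_le (by rintro _ rfl; exact ⟨i, rfl⟩)

/-- `L_{(g_1, …, g_k)} ≅ e_1^* L_{(g_1)} ⊗ ⋯ ⊗ e_k^* L_{(g_k)}`. -/
theorem nonempty_multiLineBundleIso {k : ℕ} (g : Fin k → G) :
    Nonempty (FlatLineBundle.Iso (multiLineBundle A α g)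
      (FlatLineBundle.prod (List.ofFn fun i =>
        (lineBundle A α (g i)).pullback (A.eval g i)))) := by
  let χ : Fin k → GroupoidAction.cent g →* Circle := fun i =>
    (twistedChar α (g i)).comp (Subgroup.inclusion (cent_le_apply g i))
  have e : (twistedChar α (List.ofFn g).prod).comp (Subgroup.inclusion (cent_le_prod g)) =
      (List.ofFn χ).prod := by
    ext1 x
    refine (twistedChar_list_prod α g x (cent_le_prod g x.2)
      fun i => cent_le_apply g i x.2).trans ?_
    -- Evaluation at x is a homomorphism on characters, so it commutes with the product of the list.
    rw [← MonoidHom.eval_apply_apply, map_list_prod, List.map_ofFn]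
    rfl
  rw [multiLineBundle, e]
  exact FlatLineBundle.nonempty_assocProdIso (A.fixedAction g) χ _ fun i =>
    -- The evaluation map keeps the group element, so the characters agree by definition.
    ⟨FlatLineBundle.assocPullbackIso _ _ _ _ (A.eval g i) fun _ => rfl⟩

end

end DiscreteTorsion

theorem lemma4p2 {n : ℕ} (Y : DiscreteTorsion.Orbifold n) {G : Type*} [Group G]
    (A : DiscreteTorsion.SmoothAction G Y) (α : DiscreteTorsion.H2 G) :
    -- (1) `t × Id` is an isomorphism `L_g ≅ L_{tgt⁻¹}` over the isomorphism `t` of sectors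
    (∀ g t : G, (A.translate t g).IsIso ∧
      ∃ Φ : DiscreteTorsion.FlatLineBundle.Iso
          (DiscreteTorsion.lineBundle A.toGroupoidAction α g)
          ((DiscreteTorsion.lineBundle A.toGroupoidAction α (t * g * t⁻¹)).pullback
            (A.translate t g)),
        ∀ (p : (A.sector g).Obj) (v : ℂ), Φ.lin p v = v) ∧
    -- (2) `L_{(g)}⁻¹ = L_{(g⁻¹)}` under the isomorphism `I : X_{(g)} → X_{(g⁻¹)}`
    (∀ g : G, (A.sectorInv g).IsIso ∧
      Nonempty (DiscreteTorsion.FlatLineBundle.Iso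
        (DiscreteTorsion.lineBundle A.toGroupoidAction α g).dual
        ((DiscreteTorsion.lineBundle A.toGroupoidAction α g⁻¹).pullback (A.sectorInv g)))) ∧
    -- (3) `L_{(g_1, …, g_k)} = e_1^* L_{(g_1)} ⊗ ⋯ ⊗ e_k^* L_{(g_k)}` over `X_{(g_1, …, g_k)}`
    (∀ (k : ℕ) (g : Fin k → G),
      Nonempty (DiscreteTorsion.FlatLineBundle.Iso
        (DiscreteTorsion.multiLineBundle A.toGroupoidAction α g)
        (DiscreteTorsion.FlatLineBundle.prod (List.ofFn fun i =>
          (DiscreteTorsion.lineBundle A.toGroupoidAction α (g i)).pullback (A.eval g i))))) :=   ⟨fun g t => ⟨A.translate_isIso t g,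
      -- The isomorphism is the identity of `ℂ` on each fibre, so over t it is t × Id by definition.
      DiscreteTorsion.lineBundleTranslateIso A.toGroupoidAction α t g, fun _ _ => rfl⟩,
    fun g => ⟨A.sectorInv_isIso g,
      ⟨DiscreteTorsion.lineBundleDualIso A.toGroupoidAction α g⟩⟩,
    fun _ g => DiscreteTorsion.nonempty_multiLineBundleIso A.toGroupoidAction α g⟩
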